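/- Let $\lambda\ge 0$. For every $n\ge 1$ let $v^{(n)}\sim\mathcal{CN}(0,\lambda I_n)$ be a circularly-symmetric complex normal random vector in $\mathbb{C}^n$, and let $\omega_n$ be a randomly selected eigenvalue of the dyad $v^{(n)}(v^{(n)})^H$, i.e. one of its $n$ eigenvalues (counted with multiplicity), whose index is chosen uniformly at random and independently of $v^{(n)}$. For a nonnegative random variable $X$ let $$G_X(z)=\mathbb{E}\Big[\frac{1}{X-z}\Big],\qquad z\in\mathbb{C}\setminus[0,\infty),$$ be its Stieltjes transform, and let $\mathcal{R}_X(s)=G_X^{-1}(-s)-\frac1s$ be its R-transform, where $G_X^{-1}$ denotes the inverse function of $G_X$, with values in $\mathbb{C}\setminus[0,\infty)$. Then for every $s\in\mathbb{C}\setminus[0,\infty)$ (in particular for every real $s<0$) the value $G_{\omega_n}^{-1}(-s/n)$ is well defined for all sufficiently large $n$, i.e. there is exactly one $z\in\mathbb{C}\setminus[0,\infty)$ with $G_{\omega_n}(z)=-s/n$, and $$\lim_{n\to\infty}\mathcal{R}_{\omega_n}\Big(\frac{s}{n}\Big)=\frac{\lambda}{1-s\lambda}.$$ -/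

import Mathlib

open MeasureTheory ProbabilityTheory Filter Topology
open scoped NNReal ENNReal

noncomputable section

/-- The centred circularly-symmetric complex normal law `CN(0, lam)` on `ℂ`: the real and the
imaginary part are independent centred real normal variables of variance `lam / 2`. -/
def complexNormal (lam : ℝ≥0) : Measure ℂ :=
  ((gaussianReal 0 (lam / 2)).prod (gaussianReal 0 (lam / 2))).map
    (fun p : ℝ × ℝ => (⟨p.1, p.2⟩ : ℂ))

/-- The law `CN(0, lam • I_n)` on `ℂⁿ`: the coordinates are independent with law `CN(0, lam)`. -/
def complexNormalVec (n : ℕ) (lam : ℝ≥0) : Measure (Fin n → ℂ) :=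
  Measure.pi fun _ => complexNormal lam

/-- The dyad `v vᴴ` of a vector `v ∈ ℂⁿ`. -/
def dyad {n : ℕ} (v : Fin n → ℂ) : Matrix (Fin n) (Fin n) ℂ :=
  Matrix.vecMulVec v (star v)

theorem dyad_isHermitian {n : ℕ} (v : Fin n → ℂ) : (dyad v).IsHermitian := by
  ext i j
  simp [dyad, Matrix.vecMulVec_apply, mul_comm]

/-- The random variable `w` is a randomly selected eigenvalue of the random dyad `v vᴴ`: it is
the eigenvalue (with multiplicity) whose index `J` is uniform on the `n` indices and
independent of `v`. -/
def IsRandomEigenvalueOfDyad {Ω : Type*} [MeasurableSpace Ω] (P : Measure Ω) {n : ℕ}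
    (v : Ω → Fin n → ℂ) (w : Ω → ℝ) : Prop :=
  ∃ J : Ω → Fin n, Measurable J ∧ (∀ i, P (J ⁻¹' {i}) = (n : ℝ≥0∞)⁻¹) ∧ IndepFun J v P ∧
    ∀ᵐ x ∂P, w x = (dyad_isHermitian (v x)).eigenvalues (J x)

/-- The Stieltjes transform `G_X(z) = E[1 / (X - z)]` of a real random variable `X`. -/
def stieltjes {Ω : Type*} [MeasurableSpace Ω] (P : Measure Ω) (X : Ω → ℝ) (z : ℂ) : ℂ :=
  ∫ x, 1 / ((X x : ℂ) - z) ∂P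

/-- The complex plane cut along `[0, ∞)`: the domain of the Stieltjes transform of a
nonnegative random variable. -/
def cutPlane : Set ℂ := {z | z.re < 0 ∨ z.im ≠ 0}

/-- The inverse function `G_X⁻¹` of the Stieltjes transform of a nonnegative random variable,
with values in the cut plane. -/
def stieltjesInv {Ω : Type*} [MeasurableSpace Ω] (P : Measure Ω) (X : Ω → ℝ) : ℂ → ℂ :=
  Function.invFunOn (stieltjes P X) cutPlane

/-- The R-transform `R_X(s) = G_X⁻¹(-s) - 1 / s` of a nonnegative random variable `X`. -/
def rTransform {Ω : Type*} [MeasurableSpace Ω] (P : Measure Ω) (X : Ω → ℝ) (s : ℂ) : ℂ :=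
  stieltjesInv P X (-s) - 1 / s

end

/-! The dyad has at most one nonzero eigenvalue, `X = sqNorm v`. With `g(z) = E[1/(X - z)]`, the
equation `G(z) = -s/n` becomes `g(z) - (n-1)/z = -s` (`stieltjes_randomEigenvalue`), that is, `z =
(n-1)/(s + h)` with `h = g(z)`.

For `lam ≠ 0`, `g` tends to `0` uniformly on the cut plane (`norm_stieltjes_sqNorm_le`). So `h` is a
fixed point of `h ↦ g((n-1)/(s+h))` on a small ball, where this map is a contraction for large `n`;
this gives existence and uniqueness of `z`. Since `X/n → lam` in `L¹`, `n * h → s/(lam*s - 1)`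
(`norm_mul_stieltjes_sub_le`), and `z - n/s = -(s + n*h)/(s*(s + h))` then has the stated limit. For
`lam = 0` the root is exactly `n/s`. -/

/-- The squared Euclidean norm of a vector in `ℂⁿ`. -/
noncomputable def sqNorm {n : ℕ} (v : Fin n → ℂ) : ℝ := ∑ i, ‖v i‖ ^ 2

theorem sqNorm_nonneg {n : ℕ} (v : Fin n → ℂ) : 0 ≤ sqNorm v :=
  Finset.sum_nonneg fun _ _ => sq_nonneg _

@[fun_prop]
theorem measurable_sqNorm {n : ℕ} : Measurable (sqNorm (n := n)) := by
  unfold sqNorm; fun_prop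

/-! ### Spectrum of the dyad -/

open scoped ComplexOrder in
/-- One fixed index carries the only possibly nonzero eigenvalue of every dyad of size `n`. -/
theorem exists_index_eigenvalues_dyad (n : ℕ) (hn : 1 ≤ n) :
    ∃ i₀ : Fin n, ∀ (v : Fin n → ℂ) (i : Fin n),
      (dyad_isHermitian v).eigenvalues i = if i = i₀ then sqNorm v else 0 := by
  classical
  set e : Fin (Fintype.card (Fin n)) ≃ Fin n := Fintype.equivOfCardEq (Fintype.card_fin _) with he
  have hn' : 0 < Fintype.card (Fin n) := by rw [Fintype.card_fin]; exact hn
  refine ⟨e ⟨0, hn'⟩, fun v i => ?_⟩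
  set hA := dyad_isHermitian v
  -- Eigenvalues are listed in decreasing order along `e`, so the position of the largest one does
  -- not depend on `v`.
  have hev : ∀ i, hA.eigenvalues i = hA.eigenvalues₀ (e.symm i) := fun i => rfl
  have hpos : ∀ i, 0 ≤ hA.eigenvalues i :=
    (Matrix.posSemidef_vecMulVec_self_star v).eigenvalues_nonneg
  have hzero : ∀ i, i ≠ e ⟨0, hn'⟩ → hA.eigenvalues i = 0 := by
    intro i hi
    by_contra hne
    have hle : hA.eigenvalues i ≤ hA.eigenvalues (e ⟨0, hn'⟩) := by
      rw [hev, hev, Equiv.symm_apply_apply]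
      exact hA.eigenvalues₀_antitone (Fin.mk_le_of_le_val (Nat.zero_le _))
    have hne' : hA.eigenvalues (e ⟨0, hn'⟩) ≠ 0 :=
      ((lt_of_le_of_ne (hpos i) (Ne.symm hne)).trans_le hle).ne'
    have hrank : (dyad v).rank ≤ 1 := Matrix.rank_vecMulVec_le v (star v)
    rw [hA.rank_eq_card_non_zero_eigs, Fintype.card_le_one_iff] at hrank
    exact hi (congrArg Subtype.val (hrank ⟨i, hne⟩ ⟨_, hne'⟩))
  split_ifs with h
  · subst h
    have ht := hA.trace_eq_sum_eigenvalues
    rw [Finset.sum_eq_single (e ⟨0, hn'⟩) (fun i _ hi => by simp [hzero i hi]) (by simp)] at ht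
    have : (dyad v).trace = ((sqNorm v : ℝ) : ℂ) := by
      simp [dyad, Matrix.trace, Matrix.vecMulVec_apply, sqNorm, Complex.mul_conj']
    rw [this] at ht
    exact Complex.ofReal_injective ht.symm
  · exact hzero i h

/-! ### Stieltjes transforms on the cut plane -/

theorem exists_le_norm_ofReal_sub {z : ℂ} (hz : z ∈ cutPlane) :
    ∃ d > 0, ∀ x : ℝ, 0 ≤ x → d ≤ ‖(x : ℂ) - z‖ := by
  rcases hz with hz | hz
  · refine ⟨-z.re, by linarith, fun x hx => ?_⟩
    have := (le_abs_self _).trans (Complex.abs_re_le_norm ((x : ℂ) - z))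
    simp at this; linarith
  · refine ⟨|z.im|, by positivity, fun x hx => ?_⟩
    simpa using Complex.abs_im_le_norm ((x : ℂ) - z)

theorem ofReal_sub_ne_zero {z : ℂ} (hz : z ∈ cutPlane) {x : ℝ} (hx : 0 ≤ x) :
    (x : ℂ) - z ≠ 0 := by
  obtain ⟨d, hd, h⟩ := exists_le_norm_ofReal_sub hz
  exact norm_pos_iff.mp (hd.trans_le (h x hx))

theorem ne_zero_of_mem_cutPlane {z : ℂ} (hz : z ∈ cutPlane) : z ≠ 0 := by
  simpa using ofReal_sub_ne_zero hz le_rfl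

/-- The resolvent of a nonnegative random variable is integrable off the half-line. -/
theorem integrable_one_div_ofReal_sub {α : Type*} [MeasurableSpace α] {μ : Measure α}
    [IsFiniteMeasure μ] {X : α → ℝ} (hX : AEMeasurable X μ) (h0 : ∀ a, 0 ≤ X a) {z : ℂ}
    (hz : z ∈ cutPlane) : Integrable (fun a => 1 / ((X a : ℂ) - z)) μ := by
  obtain ⟨d, hd, h⟩ := exists_le_norm_ofReal_sub hz
  refine Integrable.of_bound (C := 1 / d) ?_ (.of_forall fun a => ?_)
  · refine AEMeasurable.aestronglyMeasurable ?_
    fun_prop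
  · rw [norm_div, norm_one]
    exact one_div_le_one_div_of_le hd (h _ (h0 a))

/-- The resolvent of `w` is `1{J = i₀} * (1/(X - z) + 1/z) - 1/z`; independence factors the
expectation of the product, and `J = i₀` has probability `1/n`. -/
theorem stieltjes_randomEigenvalue {Ω : Type*} [MeasurableSpace Ω] {P : Measure Ω}
    [IsProbabilityMeasure P] {n : ℕ} (hn : 1 ≤ n) {v : Ω → Fin n → ℂ} {w : Ω → ℝ}
    {ν : Measure (Fin n → ℂ)} (hv : HasLaw v ν P) (hw : IsRandomEigenvalueOfDyad P v w)
    {z : ℂ} (hz : z ∈ cutPlane) :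
    stieltjes P w z = (stieltjes ν sqNorm z - (n - 1) / z) / n := by
  obtain ⟨J, hJ, hunif, hind, hwJ⟩ := hw
  obtain ⟨i₀, hi₀⟩ := exists_index_eigenvalues_dyad n hn
  have hz0 := ne_zero_of_mem_cutPlane hz
  have hn0 : (n : ℂ) ≠ 0 := by exact_mod_cast (by omega : n ≠ 0)
  have hvm : AEMeasurable v P := hv.aemeasurable
  have hXm : AEMeasurable (fun x => sqNorm (v x)) P := by fun_prop
  have hint := integrable_one_div_ofReal_sub hXm (fun x => sqNorm_nonneg (v x)) hz
  let φ : Fin n → ℂ := fun i => if i = i₀ then 1 else 0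
  let f : (Fin n → ℂ) → ℂ := fun u => 1 / ((sqNorm u : ℂ) - z) + 1 / z
  have hf : Measurable f := by fun_prop
  have hfint : Integrable (fun x => f (v x)) P := hint.add (integrable_const _)
  have hφ : Measurable φ := measurable_of_finite φ
  have hprod : ∫ x, φ (J x) * f (v x) ∂P = (∫ x, φ (J x) ∂P) * ∫ x, f (v x) ∂P :=
    hind.integral_fun_comp_mul_comp hJ.aemeasurable hvm hφ.aestronglyMeasurable
      hf.aestronglyMeasurable
  have hφint : ∫ x, φ (J x) ∂P = (n : ℂ)⁻¹ := by
    have : (fun x => φ (J x)) = (J ⁻¹' {i₀}).indicator fun _ => (1 : ℂ) := by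
      ext x; simp [φ, Set.indicator]
    rw [this, integral_indicator_const _ (hJ (measurableSet_singleton _)), measureReal_def, hunif]
    simp
  have hprodint : Integrable (fun x => φ (J x) * f (v x)) P := by
    refine hfint.bdd_mul (c := 1) (hφ.comp hJ).aestronglyMeasurable (.of_forall fun x => ?_)
    simp only [φ]; split_ifs <;> simp
  have hlaw : stieltjes ν sqNorm z = ∫ x, 1 / ((sqNorm (v x) : ℂ) - z) ∂P := by
    rw [stieltjes, ← hv.map_eq, integral_map hvm]
    exact Measurable.aestronglyMeasurable (by fun_prop)
  have key : stieltjes P w z = ∫ x, (φ (J x) * f (v x) - 1 / z) ∂P := by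
    refine integral_congr_ae ?_
    filter_upwards [hwJ] with x hx
    rw [hx, hi₀]
    simp only [φ, f]
    split_ifs <;> simp
  rw [key, integral_sub hprodint (integrable_const _), hprod, hφint]
  simp only [f]
  rw [integral_add hint (integrable_const _), ← hlaw]
  simp
  field_simp
  ring

/-! ### Laplace transform of the squared norm -/

theorem measurable_complex_mk : Measurable fun p : ℝ × ℝ => (⟨p.1, p.2⟩ : ℂ) :=
  Complex.measurableEquivRealProd.symm.measurable

instance (lam : ℝ≥0) : IsProbabilityMeasure (complexNormal lam) :=
  Measure.isProbabilityMeasure_map measurable_complex_mk.aemeasurable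

instance (n : ℕ) (lam : ℝ≥0) : IsProbabilityMeasure (complexNormalVec n lam) := by
  unfold complexNormalVec; infer_instance

/-- The two factors are the real and imaginary parts of one coordinate; squaring also removes the
branch of the complex square root. -/
theorem integral_exp_neg_mul_sq_gaussianReal_sq {lam : ℝ≥0} (hlam : lam ≠ 0) {p : ℂ}
    (hp : 0 ≤ p.re) :
    (∫ x : ℝ, Complex.exp (-p * (x : ℂ) ^ 2) ∂gaussianReal 0 (lam / 2)) ^ 2
      = (1 + lam * p)⁻¹ := by
  have hl : (0 : ℝ) < lam := by exact_mod_cast pos_iff_ne_zero.mpr hlam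
  have hlc : (lam : ℂ) ≠ 0 := by exact_mod_cast hl.ne'
  set b : ℂ := ((lam : ℝ)⁻¹ : ℝ) + p with hb
  have hbre : 0 < b.re := by
    simp only [hb, Complex.add_re, Complex.ofReal_re]
    have := inv_pos.mpr hl
    linarith
  have hb0 : b ≠ 0 := fun h => by simp [h] at hbre
  have hlb : (lam : ℂ) * b = 1 + lam * p := by
    rw [hb]; push_cast; field_simp
  rw [integral_gaussianReal_eq_integral_smul (by simpa using hlam)]
  have : (fun x : ℝ => gaussianPDFReal 0 (lam / 2) x • Complex.exp (-p * (x : ℂ) ^ 2)) =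
      fun x : ℝ => (((√(Real.pi * lam))⁻¹ : ℝ) : ℂ) * Complex.exp (-b * (x : ℂ) ^ 2) := by
    ext x
    rw [gaussianPDFReal, Complex.real_smul, Complex.ofReal_mul, mul_assoc, Complex.ofReal_exp,
      ← Complex.exp_add]
    congr 3
    · push_cast; ring_nf
    · rw [hb]; push_cast; field_simp; ring
  rw [this, integral_const_mul, integral_gaussian_complex hbre, mul_pow]
  have h2 : ((Real.pi / b : ℂ) ^ (1 / 2 : ℂ)) ^ 2 = Real.pi / b := by
    rw [show (1 / 2 : ℂ) = ((2 : ℕ) : ℂ)⁻¹ by norm_num]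
    exact Complex.cpow_nat_inv_pow _ two_ne_zero
  rw [h2, ← Complex.ofReal_pow, inv_pow, Real.sq_sqrt (by positivity), ← hlb]
  have : (Real.pi : ℂ) ≠ 0 := by exact_mod_cast Real.pi_ne_zero
  push_cast
  field_simp

theorem integral_exp_neg_mul_normSq_complexNormal {lam : ℝ≥0} (hlam : lam ≠ 0) {p : ℂ}
    (hp : 0 ≤ p.re) :
    ∫ u : ℂ, Complex.exp (-p * ((‖u‖ ^ 2 : ℝ) : ℂ)) ∂complexNormal lam = (1 + lam * p)⁻¹ := by
  rw [complexNormal, integral_map measurable_complex_mk.aemeasurable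
    (Measurable.aestronglyMeasurable (by fun_prop)),
    ← integral_exp_neg_mul_sq_gaussianReal_sq hlam hp, sq, ← integral_prod_mul]
  congr 1 with x
  rw [← Complex.exp_add, Complex.sq_norm, Complex.normSq_mk]
  congr 1
  push_cast
  ring

/-- The Laplace transform of the squared norm of a complex normal vector. -/
theorem integral_exp_neg_mul_sqNorm {lam : ℝ≥0} (hlam : lam ≠ 0) (n : ℕ) {p : ℂ}
    (hp : 0 ≤ p.re) :
    ∫ u, Complex.exp (-p * (sqNorm u : ℂ)) ∂complexNormalVec n lam = ((1 + lam * p)⁻¹) ^ n := by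
  rw [← integral_exp_neg_mul_normSq_complexNormal hlam hp, complexNormalVec]
  conv_rhs => rw [← Fintype.card_fin n]
  rw [← integral_fintype_prod_eq_pow (ι := Fin n)
    (fun u : ℂ => Complex.exp (-p * ((‖u‖ ^ 2 : ℝ) : ℂ)))]
  congr 1 with u
  rw [← Complex.exp_sum, sqNorm, ← Finset.mul_sum]
  push_cast
  rfl

/-! ### Uniform decay of the Stieltjes transform -/

/-- The bound for the Stieltjes transform of the squared norm of a complex normal vector. -/
noncomputable def stieltjesBound (lam : ℝ≥0) (n : ℕ) : ℝ :=
  ∫ t in Set.Ioi (0 : ℝ), ((√(1 + (lam * t) ^ 2))⁻¹) ^ n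

theorem integrable_inv_sqrt_pow {lam : ℝ≥0} (hlam : lam ≠ 0) {n : ℕ} (hn : 2 ≤ n) :
    Integrable fun t : ℝ => ((√(1 + (lam * t) ^ 2))⁻¹) ^ n := by
  have hl : (lam : ℝ) ≠ 0 := by exact_mod_cast hlam
  refine (integrable_inv_one_add_sq.comp_mul_left' hl).mono'
    (Measurable.aestronglyMeasurable (by fun_prop)) (.of_forall fun t => ?_)
  have h1 : 1 ≤ √(1 + (lam * t) ^ 2) := Real.one_le_sqrt.mpr (by nlinarith [sq_nonneg (lam * t)])
  rw [Real.norm_of_nonneg (by positivity)]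
  calc ((√(1 + (lam * t) ^ 2))⁻¹) ^ n ≤ ((√(1 + (lam * t) ^ 2))⁻¹) ^ 2 :=
        pow_le_pow_of_le_one (by positivity) (inv_le_one_of_one_le₀ h1) hn
    _ = (1 + (lam * t) ^ 2)⁻¹ := by rw [inv_pow, Real.sq_sqrt (by positivity)]

theorem tendsto_stieltjesBound {lam : ℝ≥0} (hlam : lam ≠ 0) :
    Tendsto (stieltjesBound lam) atTop (𝓝 0) := by
  have hl : (0 : ℝ) < lam := by exact_mod_cast pos_iff_ne_zero.mpr hlam
  rw [← tendsto_add_atTop_iff_nat 2]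
  have := tendsto_integral_of_dominated_convergence
    (μ := volume.restrict (Set.Ioi (0 : ℝ)))
    (F := fun n t => ((√(1 + (lam * t) ^ 2))⁻¹) ^ (n + 2)) (f := fun _ => 0)
    (fun t : ℝ => ((√(1 + (lam * t) ^ 2))⁻¹) ^ 2)
    (fun n => Measurable.aestronglyMeasurable (by fun_prop))
    (integrable_inv_sqrt_pow hlam le_rfl).integrableOn
    (fun n => .of_forall fun t => ?_) ?_
  · simpa [stieltjesBound] using this
  · have h1 : 1 ≤ √(1 + (lam * t) ^ 2) :=
      Real.one_le_sqrt.mpr (by nlinarith [sq_nonneg (lam * t)])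
    rw [Real.norm_of_nonneg (by positivity)]
    exact pow_le_pow_of_le_one (by positivity) (inv_le_one_of_one_le₀ h1) (by omega)
  · refine (ae_restrict_iff' measurableSet_Ioi).mpr (.of_forall fun t (ht : 0 < t) => ?_)
    rw [tendsto_add_atTop_iff_nat 2 (f := fun n => ((√(1 + (lam * t) ^ 2))⁻¹) ^ n)]
    refine tendsto_pow_atTop_nhds_zero_of_lt_one (by positivity) (inv_lt_one_of_one_lt₀ ?_)
    rw [Real.lt_sqrt one_pos.le]
    have : 0 < (lam * t) ^ 2 := by positivity
    linarith

/-- Direction of the ray for the Laplace integral: `exp(p*z*t)` decays, while `0 ≤ p.re` keeps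
`exp(-p*X*t)` bounded. -/
theorem exists_direction {z : ℂ} (hz : z ∈ cutPlane) :
    ∃ p : ℂ, 0 ≤ p.re ∧ ‖p‖ = 1 ∧ (p * z).re < 0 := by
  rcases hz with hz | hz
  · exact ⟨1, by simp, by simp, by simpa using hz⟩
  · rcases lt_or_gt_of_ne hz with hz | hz
    · exact ⟨-Complex.I, by simp, by simp, by simpa using hz⟩
    · exact ⟨Complex.I, by simp, by simp, by simpa using hz⟩

/-- Write `1/(X - z) = p * ∫ exp(-p*(X - z)*t) dt` over `t > 0` and swap the integrals: the inner
expectation is `exp(p*z*t) * (1 + lam*p*t)⁻ⁿ`. The bound does not depend on `z`, even near the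
half-line. -/
theorem norm_stieltjes_sqNorm_le {lam : ℝ≥0} (hlam : lam ≠ 0) {n : ℕ} (hn : 2 ≤ n) {z : ℂ}
    (hz : z ∈ cutPlane) :
    ‖stieltjes (complexNormalVec n lam) sqNorm z‖ ≤ stieltjesBound lam n := by
  obtain ⟨p, hp, hp1, hpz⟩ := exists_direction hz
  have hp0 : p ≠ 0 := norm_ne_zero_iff.mp (by rw [hp1]; norm_num)
  set μ := complexNormalVec n lam
  let F : (Fin n → ℂ) → ℝ → ℂ := fun u t => Complex.exp (-p * ((sqNorm u : ℂ) - z) * t)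
  have hre : ∀ u : Fin n → ℂ, (-p * ((sqNorm u : ℂ) - z)).re ≤ (p * z).re := by
    intro u
    have : (-p * ((sqNorm u : ℂ) - z)).re = (p * z).re - p.re * sqNorm u := by
      simp [Complex.mul_re]; ring
    nlinarith [sqNorm_nonneg u]
  have hlap : ∀ u : Fin n → ℂ, 1 / ((sqNorm u : ℂ) - z) = p * ∫ t in Set.Ioi (0 : ℝ), F u t := by
    intro u
    have h0 := ofReal_sub_ne_zero hz (sqNorm_nonneg u)
    rw [integral_exp_mul_complex_Ioi ((hre u).trans_lt hpz)]
    simp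
    field_simp
  have hFint : Integrable (Function.uncurry F) (μ.prod (volume.restrict (Set.Ioi (0 : ℝ)))) := by
    have hdom : Integrable (fun q : (Fin n → ℂ) × ℝ => (1 : ℝ) * Real.exp ((p * z).re * q.2))
        (μ.prod (volume.restrict (Set.Ioi (0 : ℝ)))) :=
      (integrable_const (1 : ℝ)).mul_prod (integrableOn_exp_mul_Ioi hpz 0)
    refine hdom.mono' (Measurable.aestronglyMeasurable ?_) ?_
    · unfold F Function.uncurry; fun_prop
    · have : ∀ᵐ q : (Fin n → ℂ) × ℝ ∂(μ.prod (volume.restrict (Set.Ioi (0 : ℝ)))), 0 < q.2 :=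
        Measure.quasiMeasurePreserving_snd.ae (ae_restrict_mem measurableSet_Ioi)
      filter_upwards [this] with q hq
      rw [Function.uncurry, Complex.norm_exp, one_mul, Real.exp_le_exp, Complex.re_mul_ofReal]
      exact mul_le_mul_of_nonneg_right (hre _) hq.le
  have hinner : ∀ t ∈ Set.Ioi (0 : ℝ), ‖∫ u, F u t ∂μ‖ ≤ ((√(1 + (lam * t) ^ 2))⁻¹) ^ n := by
    intro t (ht : 0 < t)
    have hF : ∀ u, F u t = Complex.exp (p * z * t) * Complex.exp (-(p * t) * (sqNorm u : ℂ)) := by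
      intro u
      rw [← Complex.exp_add]
      simp only [F]
      congr 1
      ring
    have hpt : 0 ≤ (p * t).re := by rw [Complex.re_mul_ofReal]; positivity
    simp_rw [hF]
    rw [integral_const_mul, integral_exp_neg_mul_sqNorm hlam n hpt, norm_mul, norm_pow, norm_inv,
      Complex.norm_exp, Complex.re_mul_ofReal]
    have h1 : Real.exp ((p * z).re * t) ≤ 1 := Real.exp_le_one_iff.mpr (by nlinarith)
    -- The squared modulus is `1 + 2*lam*t*p.re + (lam*t)^2`, whose middle term is nonnegative.
    have h2 : √(1 + (lam * t) ^ 2) ≤ ‖1 + (lam : ℂ) * (p * t)‖ := by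
      rw [Real.sqrt_le_left (norm_nonneg _), Complex.sq_norm, Complex.normSq_apply]
      have h3 : p.re ^ 2 + p.im ^ 2 = 1 := by
        rw [← Complex.normSq_add_mul_I, Complex.re_add_im, ← Complex.sq_norm, hp1, one_pow]
      have h4 : 0 ≤ (lam : ℝ) * (p.re * t) := by positivity
      simp
      nlinarith
    have h5 : 0 < √(1 + (lam * t) ^ 2) := by positivity
    calc _ ≤ 1 * (‖1 + (lam : ℂ) * (p * t)‖⁻¹) ^ n := by gcongr
      _ ≤ _ := by rw [one_mul]; gcongr
  rw [stieltjes]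
  simp_rw [hlap]
  rw [integral_const_mul, norm_mul, hp1, one_mul, integral_integral_swap hFint, stieltjesBound]
  exact norm_integral_le_of_norm_le (integrable_inv_sqrt_pow hlam hn).integrableOn
    ((ae_restrict_iff' measurableSet_Ioi).mpr (.of_forall hinner))

/-! ### Law of large numbers in `L¹` for the squared norm -/

theorem memLp_sq_gaussianReal (v : ℝ≥0) : MemLp (fun x : ℝ => x ^ 2) 2 (gaussianReal 0 v) := by
  rw [memLp_two_iff_integrable_sq (Measurable.aestronglyMeasurable (by fun_prop))]
  have := (memLp_id_gaussianReal' (μ := 0) (v := v) 4 (by norm_num)).integrable_norm_pow (p := 4)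
    (by norm_num)
  refine this.congr (.of_forall fun x => ?_)
  simp only [id, Real.norm_eq_abs]
  rw [← pow_mul, Even.pow_abs (by decide)]

theorem integral_sq_gaussianReal (v : ℝ≥0) : ∫ x : ℝ, x ^ 2 ∂gaussianReal 0 v = v := by
  have h := variance_fun_id_gaussianReal (μ := 0) (v := v)
  rw [variance_eq_integral (by fun_prop), integral_id_gaussianReal] at h
  simpa using h

theorem memLp_normSq_complexNormal (lam : ℝ≥0) :
    MemLp (fun u : ℂ => ‖u‖ ^ 2) 2 (complexNormal lam) := by
  rw [complexNormal, memLp_map_measure_iff (Measurable.aestronglyMeasurable (by fun_prop))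
    measurable_complex_mk.aemeasurable]
  have h := memLp_sq_gaussianReal (lam / 2)
  refine ((h.comp_fst (gaussianReal 0 (lam / 2))).add
    (h.comp_snd (gaussianReal 0 (lam / 2)))).congr_norm
    (Measurable.aestronglyMeasurable ?_) (.of_forall fun x => ?_)
  · have := measurable_complex_mk
    fun_prop
  · simp only [Pi.add_apply, Function.comp_apply]
    rw [Complex.sq_norm, Complex.normSq_mk, sq, sq]

theorem integral_normSq_complexNormal (lam : ℝ≥0) :
    ∫ u : ℂ, ‖u‖ ^ 2 ∂complexNormal lam = lam := by
  rw [complexNormal, integral_map measurable_complex_mk.aemeasurable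
    (Measurable.aestronglyMeasurable (by fun_prop))]
  have h := (memLp_sq_gaussianReal (lam / 2)).integrable one_le_two
  have : ∀ x : ℝ × ℝ, ‖(⟨x.1, x.2⟩ : ℂ)‖ ^ 2 = x.1 ^ 2 + x.2 ^ 2 := fun x => by
    rw [Complex.sq_norm, Complex.normSq_mk]; ring
  simp_rw [this]
  rw [integral_add (h.comp_fst _) (h.comp_snd _)]
  rw [integral_fun_fst (μ := gaussianReal 0 (lam / 2)) (ν := gaussianReal 0 (lam / 2))
      (fun x : ℝ => x ^ 2),
    integral_fun_snd (μ := gaussianReal 0 (lam / 2)) (ν := gaussianReal 0 (lam / 2))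
      (fun x : ℝ => x ^ 2), integral_sq_gaussianReal]
  simp

theorem memLp_sqNorm (n : ℕ) (lam : ℝ≥0) : MemLp sqNorm 2 (complexNormalVec n lam) :=
  memLp_finsetSum _ fun i _ => (memLp_normSq_complexNormal lam).comp_measurePreserving
    (measurePreserving_eval (fun _ : Fin n => complexNormal lam) i)

theorem integral_sqNorm (n : ℕ) (lam : ℝ≥0) :
    ∫ u, sqNorm u ∂complexNormalVec n lam = n * lam := by
  have h := (memLp_normSq_complexNormal lam).integrable one_le_two
  unfold sqNorm complexNormalVec
  rw [integral_finsetSum _ fun i _ => integrable_comp_eval (i := i) h]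
  have : ∀ i : Fin n, ∫ u : Fin n → ℂ, ‖u i‖ ^ 2 ∂Measure.pi (fun _ => complexNormal lam) = lam :=
    fun i => (integral_comp_eval (μ := fun _ : Fin n => complexNormal lam) (i := i)
      h.aestronglyMeasurable).trans
      (integral_normSq_complexNormal lam)
  simp [this]

theorem variance_sqNorm (n : ℕ) (lam : ℝ≥0) :
    Var[sqNorm; complexNormalVec n lam] = n * Var[fun u : ℂ => ‖u‖ ^ 2; complexNormal lam] := by
  have h := variance_sum_pi (μ := fun _ : Fin n => complexNormal lam)
    (X := fun _ u => ‖u‖ ^ 2) fun _ => memLp_normSq_complexNormal lam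
  rw [Finset.sum_const, Finset.card_univ, Fintype.card_fin, nsmul_eq_mul] at h
  rw [← h, complexNormalVec]
  congr 1
  ext u
  simp [sqNorm]

/-- The mean absolute deviation is at most the standard deviation. -/
theorem integral_abs_sub_integral_le {α : Type*} [MeasurableSpace α] {μ : Measure α}
    [IsProbabilityMeasure μ] {X : α → ℝ} (hX : MemLp X 2 μ) :
    ∫ a, |X a - ∫ b, X b ∂μ| ∂μ ≤ √(Var[X; μ]) := by
  have h : MemLp (fun a => |X a - ∫ b, X b ∂μ|) 2 μ := (hX.sub (memLp_const _)).abs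
  -- Nonnegativity of the variance of `|X - E X|` is the required Cauchy–Schwarz inequality.
  have h0 := variance_nonneg (fun a => |X a - ∫ b, X b ∂μ|) μ
  rw [variance_eq_sub h] at h0
  refine Real.le_sqrt_of_sq_le ?_
  rw [variance_eq_integral hX.aestronglyMeasurable.aemeasurable]
  simp only [Pi.pow_apply, sq_abs] at h0
  linarith

theorem tendsto_integral_abs_sqNorm_div_sub (lam : ℝ≥0) :
    Tendsto (fun n : ℕ => ∫ u, |sqNorm u / n - lam| ∂complexNormalVec n lam) atTop (𝓝 0) := by
  set V := Var[fun u : ℂ => ‖u‖ ^ 2; complexNormal lam] with hV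
  have hlim : Tendsto (fun n : ℕ => √(V / n)) atTop (𝓝 0) := by
    simpa using (tendsto_const_div_atTop_nhds_zero_nat V).sqrt
  refine squeeze_zero' (.of_forall fun n => integral_nonneg fun u => abs_nonneg _) ?_ hlim
  filter_upwards [eventually_ge_atTop 1] with n hn
  have hn0 : (0 : ℝ) < n := by exact_mod_cast hn
  have h := integral_abs_sub_integral_le (memLp_sqNorm n lam)
  rw [integral_sqNorm, variance_sqNorm, ← hV] at h
  have heq : ∀ u : Fin n → ℂ, |sqNorm u / n - lam| = (n : ℝ)⁻¹ * |sqNorm u - n * lam| := by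
    intro u
    rw [← abs_of_pos (inv_pos.mpr hn0), ← abs_mul]
    congr 1
    field_simp
  simp_rw [heq]
  rw [integral_const_mul]
  calc (n : ℝ)⁻¹ * _ ≤ (n : ℝ)⁻¹ * √(n * V) := by gcongr
    _ = √(V / n) := by
      rw [← Real.sqrt_sq (inv_pos.mpr hn0).le, ← Real.sqrt_mul (by positivity)]
      congr 1
      field_simp

/-! ### Resolvent estimates at the points `m / z` -/

theorem mem_cutPlane_of_forall_ne {z : ℂ} (h : ∀ x : ℝ, 0 ≤ x → (x : ℂ) - z ≠ 0) :
    z ∈ cutPlane := by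
  by_contra hz
  simp only [cutPlane, Set.mem_ofPred_eq, not_or, not_lt, not_not] at hz
  exact h z.re hz.1 (by apply Complex.ext <;> simp [hz.2])

theorem div_mem_cutPlane {m : ℝ} (hm : 0 < m) {z : ℂ} (hz : z ∈ cutPlane) :
    (m : ℂ) / z ∈ cutPlane := by
  have hz0 := ne_zero_of_mem_cutPlane hz
  refine mem_cutPlane_of_forall_ne fun x hx h => ?_
  have hxz : (x : ℂ) * z = m := by
    rw [sub_eq_zero.mp h]; field_simp
  have hx0 : (x : ℂ) ≠ 0 := fun h0 => by
    rw [h0, zero_mul] at hxz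
    exact hm.ne (by exact_mod_cast hxz)
  refine ofReal_sub_ne_zero hz (x := m / x) (by positivity) ?_
  push_cast
  rw [← hxz]
  field_simp
  simp

/-- A point at distance at least `d` from the half-line `[0, ∞)`. -/
def FarFromHalfLine (d : ℝ) (z : ℂ) : Prop := ∀ x : ℝ, 0 ≤ x → d ≤ ‖(x : ℂ) - z‖

theorem FarFromHalfLine.mem_cutPlane {d : ℝ} (hd : 0 < d) {z : ℂ} (h : FarFromHalfLine d z) :
    z ∈ cutPlane :=
  mem_cutPlane_of_forall_ne fun x hx => norm_pos_iff.mp (hd.trans_le (h x hx))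

theorem FarFromHalfLine.add {d : ℝ} {s h : ℂ} (hs : FarFromHalfLine (2 * d) s) (hh : ‖h‖ ≤ d) :
    FarFromHalfLine d (s + h) := by
  intro x hx
  have h1 := hs x hx
  have h2 := norm_sub_norm_le ((x : ℂ) - s) h
  rw [sub_sub] at h2
  linarith

/-- The norm is at least `1 - x*M` and at least `x*d`; weighting these by `d` and `M` cancels `x`.
-/
theorem FarFromHalfLine.le_norm_mul_sub_one {d M : ℝ} (hd : 0 < d) {z : ℂ}
    (h : FarFromHalfLine d z) (hM : ‖z‖ ≤ M) {x : ℝ} (hx : 0 ≤ x) :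
    d / (d + M) ≤ ‖(x : ℂ) * z - 1‖ := by
  have hM0 := (norm_nonneg z).trans hM
  have h1 : 1 - x * M ≤ ‖(x : ℂ) * z - 1‖ := by
    have := norm_sub_norm_le (1 : ℂ) (x * z)
    rw [norm_sub_rev, norm_one, norm_mul, Complex.norm_of_nonneg hx] at this
    nlinarith
  have h2 : x * d ≤ ‖(x : ℂ) * z - 1‖ := by
    rcases hx.eq_or_lt with rfl | hx
    · simp
    · have : (x : ℂ) * z - 1 = -(x * (((x⁻¹ : ℝ) : ℂ) - z)) := by
        have : (x : ℂ) ≠ 0 := by exact_mod_cast hx.ne'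
        push_cast; field_simp; ring
      rw [this, norm_neg, norm_mul, Complex.norm_of_nonneg hx.le]
      exact mul_le_mul_of_nonneg_left (h _ (by positivity)) hx.le
  rw [div_le_iff₀ (by positivity)]
  nlinarith

section Resolvent

variable {α : Type*} [MeasurableSpace α] {μ : Measure α} [IsProbabilityMeasure μ] {X : α → ℝ}
  {d M m : ℝ} {z z' : ℂ}

theorem one_div_ofReal_sub_div (hm : 0 < m) (hz : z ∈ cutPlane) {x : ℝ} (hx : 0 ≤ x) :
    1 / ((x : ℂ) - m / z) = z / m / (((x / m : ℝ) : ℂ) * z - 1) := by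
  have hz0 := ne_zero_of_mem_cutPlane hz
  have hm0 : (m : ℂ) ≠ 0 := by exact_mod_cast hm.ne'
  have h := ofReal_sub_ne_zero (div_mem_cutPlane hm hz) hx
  have h1 : (x : ℂ) - m / z = (m / z) * (((x / m : ℝ) : ℂ) * z - 1) := by
    push_cast; field_simp
  rw [h1] at h ⊢
  have h2 := right_ne_zero_of_mul h
  field_simp

/-- With `y = X/m` the integrand is `(z/m)/(y*z - 1)`, whose denominator stays away from `0`
uniformly in `y`. The gain `1/m` is what produces a contraction. -/
theorem norm_stieltjes_sub_stieltjes_le (hX : Measurable X) (h0 : ∀ a, 0 ≤ X a) (hd : 0 < d)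
    (hm : 0 < m) (hz : FarFromHalfLine d z) (hzM : ‖z‖ ≤ M) (hz' : FarFromHalfLine d z')
    (hzM' : ‖z'‖ ≤ M) :
    ‖stieltjes μ X (m / z) - stieltjes μ X (m / z')‖ ≤ ‖z - z'‖ / (m * (d / (d + M)) ^ 2) := by
  have hM0 := (norm_nonneg z).trans hzM
  have hc : 0 < d / (d + M) := by positivity
  have hcz := hz.mem_cutPlane hd
  have hcz' := hz'.mem_cutPlane hd
  have hm0 : (m : ℂ) ≠ 0 := by exact_mod_cast hm.ne'
  rw [stieltjes, stieltjes, ← integral_sub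
    (integrable_one_div_ofReal_sub hX.aemeasurable h0 (div_mem_cutPlane hm hcz))
    (integrable_one_div_ofReal_sub hX.aemeasurable h0 (div_mem_cutPlane hm hcz'))]
  refine (norm_integral_le_of_norm_le_const (C := ‖z - z'‖ / (m * (d / (d + M)) ^ 2))
    (.of_forall fun a => ?_)).trans_eq (by simp)
  rw [one_div_ofReal_sub_div hm hcz (h0 a), one_div_ofReal_sub_div hm hcz' (h0 a)]
  have hy : 0 ≤ X a / m := div_nonneg (h0 a) hm.le
  have h1 := hz.le_norm_mul_sub_one hd hzM hy
  have h2 := hz'.le_norm_mul_sub_one hd hzM' hy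
  set y := X a / m
  have h1' : (y : ℂ) * z - 1 ≠ 0 := norm_pos_iff.mp (hc.trans_le h1)
  have h2' : (y : ℂ) * z' - 1 ≠ 0 := norm_pos_iff.mp (hc.trans_le h2)
  have : z / m / ((y : ℂ) * z - 1) - z' / m / ((y : ℂ) * z' - 1)
      = (z' - z) / (m * (((y : ℂ) * z - 1) * ((y : ℂ) * z' - 1))) := by
    rw [div_div, div_div, div_sub_div _ _ (mul_ne_zero hm0 h1') (mul_ne_zero hm0 h2'),
      div_eq_div_iff (by positivity) (by positivity)]
    ring
  rw [this, norm_div, norm_mul, norm_mul, Complex.norm_of_nonneg hm.le, norm_sub_rev, sq]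
  gcongr

/-- Replacing `X/m` by `lam` in the rescaled resolvent costs a bounded multiple of `|X/m - lam|`. -/
theorem norm_mul_stieltjes_sub_le (hX : Measurable X) (hXi : Integrable X μ) (h0 : ∀ a, 0 ≤ X a)
    (hd : 0 < d) (hm : 0 < m) (hz : FarFromHalfLine d z) (hzM : ‖z‖ ≤ M) (lam : ℝ≥0) :
    ‖m * stieltjes μ X (m / z) - z / (lam * z - 1)‖
      ≤ M ^ 2 / (d / (d + M)) ^ 2 * ∫ a, |X a / m - lam| ∂μ := by
  have hM0 := (norm_nonneg z).trans hzM
  have hc : 0 < d / (d + M) := by positivity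
  have hcz := hz.mem_cutPlane hd
  have hm0 : (m : ℂ) ≠ 0 := by exact_mod_cast hm.ne'
  have hint := integrable_one_div_ofReal_sub (μ := μ) hX.aemeasurable h0 (div_mem_cutPlane hm hcz)
  have h2 : d / (d + M) ≤ ‖((lam : ℝ) : ℂ) * z - 1‖ := hz.le_norm_mul_sub_one hd hzM lam.coe_nonneg
  have hconst : z / (lam * z - 1) = ∫ _ : α, z / (lam * z - 1) ∂μ := by simp
  rw [stieltjes, ← integral_const_mul, hconst, ← integral_sub (hint.const_mul _)
    (integrable_const _), ← integral_const_mul]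
  refine norm_integral_le_of_norm_le (((hXi.div_const m).sub (integrable_const _)).abs.const_mul _)
    (.of_forall fun a => ?_)
  rw [one_div_ofReal_sub_div hm hcz (h0 a)]
  have hy : 0 ≤ X a / m := div_nonneg (h0 a) hm.le
  have h1 := hz.le_norm_mul_sub_one hd hzM hy
  set y := X a / m
  have h1' : (y : ℂ) * z - 1 ≠ 0 := norm_pos_iff.mp (hc.trans_le h1)
  have h2' : ((lam : ℝ) : ℂ) * z - 1 ≠ 0 := norm_pos_iff.mp (hc.trans_le h2)
  have : m * (z / m / ((y : ℂ) * z - 1)) - z / (((lam : ℝ) : ℂ) * z - 1)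
      = z ^ 2 * -((y - lam : ℝ) : ℂ) / (((y : ℂ) * z - 1) * (((lam : ℝ) : ℂ) * z - 1)) := by
    rw [mul_div_assoc', mul_div_cancel₀ _ hm0, div_sub_div _ _ h1' h2']
    push_cast
    ring
  refine le_of_eq_of_le (congrArg norm this) ?_
  rw [norm_div, norm_mul, norm_mul, norm_neg, Complex.norm_real, Real.norm_eq_abs, norm_pow,
    mul_div_right_comm, sq (d / (d + M))]
  gcongr

end Resolvent

/-! ### Fixed point and asymptotics of the root -/

/-- The factor `2` leaves room to perturb `s` by `d` and stay at distance `d`. -/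
theorem exists_farFromHalfLine {s : ℂ} (hs : s ∈ cutPlane) :
    ∃ d > 0, FarFromHalfLine (2 * d) s := by
  obtain ⟨d, hd, h⟩ := exists_le_norm_ofReal_sub hs
  exact ⟨d / 2, by positivity, fun x hx => by linarith [h x hx]⟩

/-- A root of the rescaled equation is the inverse of a small perturbation of `s`. -/
theorem eq_div_add_stieltjes {n : ℕ} (hn : 2 ≤ n) {g z s : ℂ} (hz : z ∈ cutPlane)
    (h : g - (n - 1) / z = -s) : s + g ≠ 0 ∧ z = ((n - 1 : ℝ) : ℂ) / (s + g) := by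
  have hz0 := ne_zero_of_mem_cutPlane hz
  have hn1 : ((n : ℂ) - 1) ≠ 0 := by
    rw [sub_ne_zero]; exact_mod_cast (by omega : n ≠ 1)
  have h1 : s + g = (n - 1) / z := by linear_combination h
  rw [h1]
  refine ⟨div_ne_zero hn1 hz0, ?_⟩
  push_cast
  field_simp

theorem eventually_existsUnique_stieltjes {lam : ℝ≥0} (hlam : lam ≠ 0) {s : ℂ}
    (hs : s ∈ cutPlane) :
    ∀ᶠ n : ℕ in atTop, ∃! z : ℂ, z ∈ cutPlane ∧
      stieltjes (complexNormalVec n lam) sqNorm z - (n - 1) / z = -s := by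
  obtain ⟨d, hd, hfar⟩ := exists_farFromHalfLine hs
  set M := ‖s‖ + d
  have hM : 0 ≤ M := by positivity
  set c := d / (d + M)
  have hc : 0 < c := by positivity
  have hε := (tendsto_stieltjesBound hlam).eventually (ge_mem_nhds hd)
  -- This makes the Lipschitz constant `1/((n-1)*c^2)` of `T` at most `1/2`.
  have hlarge : ∀ᶠ n : ℕ in atTop, 2 / c ^ 2 ≤ (n : ℝ) - 1 := by
    filter_upwards [tendsto_natCast_atTop_atTop.eventually_ge_atTop (2 / c ^ 2 + 1)] with n hn
    linarith
  filter_upwards [hε, hlarge, eventually_ge_atTop 2] with n hε hlarge hn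
  set ε := stieltjesBound lam n
  set g : ℂ → ℂ := stieltjes (complexNormalVec n lam) sqNorm with hg
  have hn1 : (0 : ℝ) < n - 1 := lt_of_lt_of_le (by positivity) hlarge
  have hn1c : ((n : ℂ) - 1) ≠ 0 := by
    have : (((n : ℝ) - 1 : ℝ) : ℂ) ≠ 0 := by exact_mod_cast hn1.ne'
    simpa using this
  have hbound : ∀ z ∈ cutPlane, ‖g z‖ ≤ ε := fun z hz => norm_stieltjes_sqNorm_le hlam hn hz
  let T : ℂ → ℂ := fun h => g (((n - 1 : ℝ) : ℂ) / (s + h))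
  set B := Metric.closedBall (0 : ℂ) ε
  have hBmem : ∀ {h}, h ∈ B → ‖h‖ ≤ ε := fun hh => mem_closedBall_zero_iff.mp hh
  have hfar' : ∀ h ∈ B, FarFromHalfLine d (s + h) := fun h hh =>
    hfar.add ((hBmem hh).trans hε)
  have hnorm : ∀ h ∈ B, ‖s + h‖ ≤ M := fun h hh =>
    (norm_add_le _ _).trans (by linarith [(hBmem hh).trans hε])
  have hcut : ∀ h ∈ B, ((n - 1 : ℝ) : ℂ) / (s + h) ∈ cutPlane := fun h hh =>
    div_mem_cutPlane hn1 ((hfar' h hh).mem_cutPlane hd)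
  have hmaps : Set.MapsTo T B B := fun h hh =>
    mem_closedBall_zero_iff.mpr (hbound _ (hcut h hh))
  have hlip : ∀ h ∈ B, ∀ h' ∈ B, ‖T h - T h'‖ ≤ 1 / 2 * ‖h - h'‖ := by
    intro h hh h' hh'
    refine (norm_stieltjes_sub_stieltjes_le measurable_sqNorm sqNorm_nonneg hd hn1 (hfar' h hh)
      (hnorm h hh) (hfar' h' hh') (hnorm h' hh')).trans ?_
    rw [add_sub_add_left_eq_sub, div_le_iff₀ (by positivity)]
    rw [div_le_iff₀ (by positivity)] at hlarge
    nlinarith [norm_nonneg (h - h')]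
  have hcontr : ContractingWith (1 / 2) (hmaps.restrict T B B) := by
    refine ⟨by rw [← NNReal.coe_lt_coe]; norm_num, LipschitzWith.of_dist_le_mul fun x y => ?_⟩
    simpa [Subtype.dist_eq, dist_eq_norm] using hlip x x.2 y y.2
  have hεnn : 0 ≤ ε := (norm_nonneg _).trans (hbound s hs)
  obtain ⟨h₀, hh₀, hfix, -⟩ := hcontr.exists_fixedPoint' Metric.isClosed_closedBall.isComplete
    hmaps (Metric.mem_closedBall_self hεnn) (edist_ne_top _ _)
  have hfix' : g (((n - 1 : ℝ) : ℂ) / (s + h₀)) = h₀ := hfix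
  have hs₀ := ne_zero_of_mem_cutPlane ((hfar' h₀ hh₀).mem_cutPlane hd)
  refine ⟨((n - 1 : ℝ) : ℂ) / (s + h₀), ⟨hcut h₀ hh₀, ?_⟩, ?_⟩
  · rw [hfix']
    push_cast
    field_simp
    ring
  · rintro z ⟨hz, hzeq⟩
    obtain ⟨-, hz'⟩ := eq_div_add_stieltjes hn hz hzeq
    -- By the uniform bound, every root in the cut plane gives a fixed point inside the ball, so
    -- uniqueness there is global.
    have hgB : g z ∈ B := mem_closedBall_zero_iff.mpr (hbound z hz)
    have hTz : T (g z) = g z := by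
      simp only [T]
      rw [← hz']
    have h1 := hlip (g z) hgB h₀ hh₀
    rw [hTz, show T h₀ = h₀ from hfix] at h1
    have h2 : ‖g z - h₀‖ = 0 := by linarith [norm_nonneg (g z - h₀)]
    rw [hz', sub_eq_zero.mp (norm_eq_zero.mp h2)]

theorem tendsto_sub_div_of_stieltjes_eq {lam : ℝ≥0} (hlam : lam ≠ 0) {s : ℂ} (hs : s ∈ cutPlane)
    {z : ℕ → ℂ} (hz : ∀ᶠ n : ℕ in atTop, z n ∈ cutPlane ∧
      stieltjes (complexNormalVec n lam) sqNorm (z n) - (n - 1) / z n = -s) :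
    Tendsto (fun n : ℕ => z n - n / s) atTop (𝓝 (lam / (1 - s * lam))) := by
  obtain ⟨d, hd, hfar⟩ := exists_farFromHalfLine hs
  set M := ‖s‖ + d
  set h : ℕ → ℂ := fun n => stieltjes (complexNormalVec n lam) sqNorm (z n) with hh
  have hs0 := ne_zero_of_mem_cutPlane hs
  have hls : (lam : ℂ) * s - 1 ≠ 0 := by
    have := hfar.le_norm_mul_sub_one (by positivity) le_rfl lam.coe_nonneg
    exact norm_pos_iff.mp (lt_of_lt_of_le (by positivity) this)
  have hlim_h : Tendsto h atTop (𝓝 0) := by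
    refine squeeze_zero_norm' ?_ (tendsto_stieltjesBound hlam)
    filter_upwards [hz, eventually_ge_atTop 2] with n hn hn2
    exact norm_stieltjes_sqNorm_le hlam hn2 hn.1
  have hlim_ratio : Tendsto (fun n : ℕ => (n : ℂ) / (n - 1)) atTop (𝓝 1) := by
    have h1 : Tendsto (fun n : ℕ => (1 : ℂ) - 1 / (n : ℂ)) atTop (𝓝 (1 - 0)) :=
      tendsto_const_nhds.sub tendsto_one_div_atTop_nhds_zero_nat
    rw [sub_zero] at h1
    have h2 := h1.inv₀ one_ne_zero
    rw [inv_one] at h2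
    refine h2.congr' ?_
    filter_upwards [eventually_ge_atTop 1] with n hn
    have : (n : ℂ) ≠ 0 := by exact_mod_cast (by omega : n ≠ 0)
    rw [one_sub_div this, inv_div]
  -- Chosen so that `z n = n / τ n`, which allows the resolvent estimate with `m = n` rather than `n
  -- - 1`.
  set τ : ℕ → ℂ := fun n => (s + h n) * (n / (n - 1)) with hτ
  have hlim_τ : Tendsto τ atTop (𝓝 s) := by
    simpa using (tendsto_const_nhds.add hlim_h).mul hlim_ratio
  have hτnear : ∀ᶠ n in atTop, ‖τ n - s‖ ≤ d := by
    have : Tendsto (fun n => ‖τ n - s‖) atTop (𝓝 0) := by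
      simpa using (hlim_τ.sub_const s).norm
    exact this.eventually (ge_mem_nhds hd)
  have hlim_nh : Tendsto (fun n => n * h n) atTop (𝓝 (s / (lam * s - 1))) := by
    have h1 : Tendsto (fun n => τ n / (lam * τ n - 1)) atTop (𝓝 (s / (lam * s - 1))) :=
      hlim_τ.div ((tendsto_const_nhds.mul hlim_τ).sub_const 1) hls
    have h2 : Tendsto (fun n => n * h n - τ n / (lam * τ n - 1)) atTop (𝓝 0) := by
      have h3 := (tendsto_integral_abs_sqNorm_div_sub lam).const_mul
        (M ^ 2 / (d / (d + M)) ^ 2)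
      rw [mul_zero] at h3
      refine squeeze_zero_norm' ?_ h3
      filter_upwards [hz, hτnear, eventually_ge_atTop 2] with n hzn hτn hn2
      have hn0 : (0 : ℝ) < n := by exact_mod_cast (by omega : 0 < n)
      obtain ⟨hne, hzeq⟩ := eq_div_add_stieltjes hn2 hzn.1 hzn.2
      have hfarτ : FarFromHalfLine d (τ n) := by simpa using hfar.add hτn
      have hnormτ : ‖τ n‖ ≤ M := by
        have := norm_add_le s (τ n - s)
        rw [add_sub_cancel] at this
        linarith
      have hzτ : z n = ((n : ℝ) : ℂ) / τ n := by
        have hn0' : (n : ℂ) ≠ 0 := by exact_mod_cast hn0.ne'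
        have hn1 : ((n : ℂ) - 1) ≠ 0 := by
          rw [sub_ne_zero]; exact_mod_cast (by omega : n ≠ 1)
        refine hzeq.trans ?_
        simp only [hτ, hh]
        push_cast
        field_simp
      have := norm_mul_stieltjes_sub_le (μ := complexNormalVec n lam) measurable_sqNorm
        ((memLp_sqNorm n lam).integrable one_le_two) sqNorm_nonneg hd hn0 hfarτ hnormτ lam
      rw [← hzτ] at this
      simpa using this
    simpa using h2.add h1
  have hlim : Tendsto (fun n => -(s + n * h n) / (s * (s + h n))) atTop
      (𝓝 (-(s + s / (lam * s - 1)) / (s * (s + 0)))) :=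
    (tendsto_const_nhds.add hlim_nh).neg.div
      (tendsto_const_nhds.mul (tendsto_const_nhds.add hlim_h)) (by simpa using hs0)
  have hval : -(s + s / (lam * s - 1)) / (s * (s + 0)) = (lam : ℂ) / (1 - s * lam) := by
    have h1 : 1 - s * (lam : ℂ) ≠ 0 := fun h0 => hls (by linear_combination -h0)
    have h2 : s + s / (lam * s - 1) = s * (s * lam) / (lam * s - 1) := by
      rw [eq_div_iff hls, add_mul, div_mul_cancel₀ _ hls]
      ring
    rw [add_zero, h2, ← div_neg, div_div, div_eq_div_iff
      (mul_ne_zero (neg_ne_zero.mpr hls) (mul_ne_zero hs0 hs0)) h1]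
    ring
  rw [hval] at hlim
  refine hlim.congr' ?_
  filter_upwards [hz, eventually_ge_atTop 2] with n hzn hn2
  obtain ⟨hne, hzeq⟩ := eq_div_add_stieltjes hn2 hzn.1 hzn.2
  have hne' : s + h n ≠ 0 := hne
  have hzeq' : z n = ((n - 1 : ℝ) : ℂ) / (s + h n) := hzeq
  rw [hzeq']
  push_cast
  field_simp
  ring

/-! ### The degenerate case `lam = 0` and the conclusion -/

theorem stieltjes_complexNormalVec_zero (n : ℕ) (z : ℂ) :
    stieltjes (complexNormalVec n 0) sqNorm z = -1 / z := by
  have h := integral_sqNorm n 0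
  rw [NNReal.coe_zero, mul_zero, integral_eq_zero_iff_of_nonneg sqNorm_nonneg
    ((memLp_sqNorm n 0).integrable one_le_two)] at h
  have : (fun u : Fin n → ℂ => 1 / ((sqNorm u : ℂ) - z)) =ᵐ[complexNormalVec n 0]
      fun _ => -1 / z := by
    filter_upwards [h] with u hu
    rw [hu]
    simp [neg_div, div_neg]
  rw [stieltjes, integral_congr_ae this]
  simp

theorem stieltjes_complexNormalVec_zero_eq_iff {n : ℕ} {s z : ℂ} (hs : s ≠ 0) (hz : z ≠ 0) :
    stieltjes (complexNormalVec n 0) sqNorm z - (n - 1) / z = -s ↔ z = n / s := by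
  rw [stieltjes_complexNormalVec_zero, eq_div_iff hs, ← sub_div, div_eq_iff hz]
  constructor <;> intro h <;> linear_combination h

/-- For every `s` in the cut plane, `G⁻¹(-s/n)` is eventually defined without ambiguity and the
R-transform of `w n` at `s / n` tends to `lam / (1 - s * lam)`. -/
theorem corollary1 (lam : ℝ≥0) {Ω : ℕ → Type*} [∀ n, MeasurableSpace (Ω n)]
    (P : ∀ n, Measure (Ω n)) [∀ n, IsProbabilityMeasure (P n)]
    (v : ∀ n, Ω n → Fin n → ℂ) (hv : ∀ n, HasLaw (v n) (complexNormalVec n lam) (P n))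
    (w : ∀ n, Ω n → ℝ) (hw : ∀ n, 1 ≤ n → IsRandomEigenvalueOfDyad (P n) (v n) (w n))
    (s : ℂ) (hs : s ∈ cutPlane) :
    (∀ᶠ n : ℕ in atTop,
      ∃! z : ℂ, z ∈ cutPlane ∧ stieltjes (P n) (w n) z = -(s / (n : ℂ))) ∧
    Tendsto (fun n : ℕ => rTransform (P n) (w n) (s / (n : ℂ))) atTop
      (𝓝 ((lam : ℂ) / (1 - s * (lam : ℂ)))) := by
  have hs0 := ne_zero_of_mem_cutPlane hs
  have hiff : ∀ n : ℕ, 1 ≤ n → ∀ z : ℂ,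
      (z ∈ cutPlane ∧ stieltjes (P n) (w n) z = -(s / (n : ℂ))) ↔
      (z ∈ cutPlane ∧ stieltjes (complexNormalVec n lam) sqNorm z - (n - 1) / z = -s) := by
    intro n hn z
    refine and_congr_right fun hz => ?_
    have hn0 : (n : ℂ) ≠ 0 := by exact_mod_cast (by omega : n ≠ 0)
    rw [stieltjes_randomEigenvalue hn (hv n) (hw n hn) hz, ← neg_div, div_left_inj' hn0]
  have hex : ∀ᶠ n : ℕ in atTop, ∃! z : ℂ, z ∈ cutPlane ∧
      stieltjes (complexNormalVec n lam) sqNorm z - (n - 1) / z = -s := by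
    rcases eq_or_ne lam 0 with rfl | hlam
    · filter_upwards [eventually_ge_atTop 1] with n hn
      have hmem : (n : ℂ) / s ∈ cutPlane := by
        simpa using div_mem_cutPlane (m := n) (by exact_mod_cast hn) hs
      exact ⟨n / s, ⟨hmem, (stieltjes_complexNormalVec_zero_eq_iff hs0
        (ne_zero_of_mem_cutPlane hmem)).mpr rfl⟩, fun z hz =>
        (stieltjes_complexNormalVec_zero_eq_iff hs0 (ne_zero_of_mem_cutPlane hz.1)).mp hz.2⟩
    · exact eventually_existsUnique_stieltjes hlam hs
  have hex' : ∀ᶠ n : ℕ in atTop,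
      ∃! z : ℂ, z ∈ cutPlane ∧ stieltjes (P n) (w n) z = -(s / (n : ℂ)) := by
    filter_upwards [hex, eventually_ge_atTop 1] with n hn hn1
    simpa only [hiff n hn1] using hn
  refine ⟨hex', ?_⟩
  set z : ℕ → ℂ := fun n => stieltjesInv (P n) (w n) (-(s / n)) with hzdef
  have hz : ∀ᶠ n : ℕ in atTop, z n ∈ cutPlane ∧
      stieltjes (complexNormalVec n lam) sqNorm (z n) - (n - 1) / z n = -s := by
    filter_upwards [hex', eventually_ge_atTop 1] with n hn hn1
    exact (hiff n hn1 _).mp (Function.invFunOn_pos hn.exists)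
  have hR : ∀ n : ℕ, rTransform (P n) (w n) (s / (n : ℂ)) = z n - n / s := fun n => by
    rw [rTransform, one_div_div]
  simp_rw [hR]
  rcases eq_or_ne lam 0 with rfl | hlam
  · refine tendsto_const_nhds.congr' ?_
    filter_upwards [hz] with n hn
    rw [(stieltjes_complexNormalVec_zero_eq_iff hs0 (ne_zero_of_mem_cutPlane hn.1)).mp hn.2]
    simp
  · exact tendsto_sub_div_of_stieltjes_eq hlam hs hz
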